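/- For $n\in\{2,3,4,\dots\}$ and real $\varphi,a$ with $$0<\varphi<\pi,\qquad 1-\frac{\varphi}{\pi}<a<2-\frac{\varphi}{\pi},\qquad \varphi+\frac{a\pi l}{n}\neq \pi k\quad(l=1,\dots,n-1,\ k\in\mathbb Z),$$ put $$S_n(\varphi,a)=\sum_{l=1}^{n-1}\csc\Big(\varphi+\frac{a\pi l}{n}\Big),$$ $$L_n(\varphi,a)=\frac na\cot\frac{n(\pi-\varphi)}{a}+\frac{n}{a\pi}\ln\frac{\tan\left(\pi-\frac12\pi a-\frac12\varphi\right)}{\tan\frac12\varphi}-\frac{\csc\varphi+\csc(\varphi+a\pi)}{2},$$ $$A=\frac{a\pi}{12}\big\{\csc\varphi\cot\varphi-\csc(\varphi+a\pi)\cot(\varphi+a\pi)\big\},$$ $$B=\frac{a^3\pi^3}{720}\big\{\csc\varphi\cot^3\varphi+5\csc^3\varphi\cot\varphi-\csc(\varphi+a\pi)\cot^3(\varphi+a\pi)-5\csc^3(\varphi+a\pi)\cot(\varphi+a\pi)\big\}.$$ If $2\varphi+a\pi<2\pi$, then $$\frac An-\frac B{n^3}<S_n(\varphi,a)-L_n(\varphi,a)<\frac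 An ;$$ if $2\varphi+a\pi>2\pi$, then $$\frac An<S_n(\varphi,a)-L_n(\varphi,a)<\frac An-\frac B{n^3}.$$ In particular (case $a=1$), let $n\in\{2,3,4,\dots\}$, $0<\varphi<\pi$ and $\varphi\neq\pi k/n$ for all $k\in\mathbb Z$, and put $$A_1=\frac{\pi\csc\varphi\cot\varphi}{6},\qquad B_1=\frac{\pi^3}{360}\big\{\csc\varphi\cot^3\varphi+5\csc^3\varphi\cot\varphi\big\},\qquad D_n=\sum_{l=1}^{n-1}\csc\Big(\varphi+\frac{\pi l}{n}\Big)+n\cot(n\varphi)+\frac{2n}{\pi}\ln\tan\frac\varphi2 .$$ Then $\frac{A_1}{n}-\frac{B_1}{n^3}<D_n<\frac{A_1}{n}$ if $0<\varphi<\frac\pi2$, and $\frac{A_1}{n}<D_n<\frac{A_1}{n}-\frac{B_1}{n^3}$ if $\frac\pi2<\varphi<\pi$. -/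

import Mathlib

namespace CosecantSum

/-- The cosecant. -/
noncomputable def csc (x : ℝ) : ℝ := 1 / Real.sin x

/-- The sum of cosecants `∑_{l=1}^{n-1} csc (φ + a π l / n)`. -/
noncomputable def S (n : ℕ) (φ a : ℝ) : ℝ :=
  ∑ l ∈ Finset.Ico 1 n, csc (φ + a * Real.pi * (l : ℝ) / (n : ℝ))

/-- The leading terms of `S n φ a`. -/
noncomputable def leading (n : ℕ) (φ a : ℝ) : ℝ :=
  (n : ℝ) / a * Real.cot ((n : ℝ) * (Real.pi - φ) / a)
    + (n : ℝ) / (a * Real.pi)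
        * Real.log (Real.tan (Real.pi - Real.pi * a / 2 - φ / 2) / Real.tan (φ / 2))
    - (csc φ + csc (φ + a * Real.pi)) / 2

/-- The coefficient of `1 / n`. -/
noncomputable def coeffA (φ a : ℝ) : ℝ :=
  a * Real.pi / 12 *
    (csc φ * Real.cot φ - csc (φ + a * Real.pi) * Real.cot (φ + a * Real.pi))

/-- The coefficient of `- 1 / n ^ 3`. -/
noncomputable def coeffB (φ a : ℝ) : ℝ :=
  a ^ 3 * Real.pi ^ 3 / 720 *
    (csc φ * Real.cot φ ^ 3 + 5 * csc φ ^ 3 * Real.cot φ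
      - csc (φ + a * Real.pi) * Real.cot (φ + a * Real.pi) ^ 3
      - 5 * csc (φ + a * Real.pi) ^ 3 * Real.cot (φ + a * Real.pi))

/-- The coefficient of `1 / n` in the simplified bounds for `a = 1`. -/
noncomputable def coeffA₁ (φ : ℝ) : ℝ := Real.pi * csc φ * Real.cot φ / 6

/-- The coefficient of `- 1 / n ^ 3` in the simplified bounds for `a = 1`. -/
noncomputable def coeffB₁ (φ : ℝ) : ℝ :=
  Real.pi ^ 3 / 360 * (csc φ * Real.cot φ ^ 3 + 5 * csc φ ^ 3 * Real.cot φ)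

end CosecantSum

namespace CosecantSum

open Real Set Filter Topology

/-! Put `h = aπ/n` and `ψ = φ + aπ - π`, which lies in `(0, π)`. On `(0, π)` the cosecant is `altPow
1 x + altPow 1 (π - x)`, where `altPow s x = ∑ (-1)^j / (x + jπ)^s`; since the sum crosses the pole
at `π`, the term `1/(π - x)` is split off (`csc_eq_altPow_add_pole`). The function `altDigamma h` is
a primitive of `altPow 1` for the difference operator of step `h`, so the regular part telescopes,
and the pole part is summed by the reflection formula, which produces the cotangent (`sum_csc_eq`).

Expanding `altDigamma` by Euler-Maclaurin turns every term but the last into an elementary function.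
With `R = altSum (remainder h)` this gives the exact identity `S - L - A/n = (R (π - ψ) - R φ) + (R
(π - φ) - R ψ)` (`S_sub_leading_eq`). Now `R` is strictly decreasing, and `φ + ψ < π` is the
condition `2φ + aπ < 2π`, so the sign is determined. The same argument for the complement
`remainder'`, with `B/n³` written through `altPow 4`, gives the other bound.

Both monotonicity claims come from one step of the trapezoidal rule for `1/x`: `stepErr` and
`stepErr'` have positive second derivative and vanish at infinity. Then `f x - f (x + p)` is
strictly decreasing, a property that survives summation over a progression and makes the alternating
sums decrease. -/

/-! ### Convex functions and their differences -/

theorem strictAntiOn_sub_shift {f f' f'' : ℝ → ℝ} (hf : ∀ x, 0 < x → HasDerivAt f (f' x) x)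
    (hf' : ∀ x, 0 < x → HasDerivAt f' (f'' x) x) (hpos : ∀ x, 0 < x → 0 < f'' x)
    {p : ℝ} (hp : 0 < p) : StrictAntiOn (fun x => f x - f (x + p)) (Ioi 0) := by
  have hmono : StrictMonoOn f' (Ioi 0) := by
    refine strictMonoOn_of_deriv_pos (convex_Ioi 0)
      (fun x hx => (hf' x hx).continuousAt.continuousWithinAt) fun x hx => ?_
    rw [interior_Ioi] at hx
    rw [(hf' x hx).deriv]
    exact hpos x hx
  have hd : ∀ x, 0 < x → HasDerivAt (fun x => f x - f (x + p)) (f' x - f' (x + p)) x :=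
    fun x hx => (hf x hx).sub ((hf (x + p) (by positivity)).comp_add_const x p)
  refine strictAntiOn_of_deriv_neg (convex_Ioi 0)
    (fun x hx => (hd x hx).continuousAt.continuousWithinAt) fun x hx => ?_
  rw [interior_Ioi] at hx
  rw [(hd x hx).deriv]
  have hx' : (0 : ℝ) < x := hx
  exact sub_neg.2 (hmono hx (show (0 : ℝ) < x + p by positivity) (by linarith))

/-- The differences `f x - f (x + 1)` decrease strictly to `0`, so they are positive; hence `f`
decreases to its limit `0` along `x, x + 1, …`. -/
theorem pos_of_strictConvex_of_tendsto_zero {f f' f'' : ℝ → ℝ}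
    (hf : ∀ x, 0 < x → HasDerivAt f (f' x) x) (hf' : ∀ x, 0 < x → HasDerivAt f' (f'' x) x)
    (hpos : ∀ x, 0 < x → 0 < f'' x) (hlim : Tendsto f atTop (𝓝 0)) {x : ℝ} (hx : 0 < x) :
    0 < f x := by
  have hanti := strictAntiOn_sub_shift hf hf' hpos one_pos
  have hlim1 : Tendsto (fun x => f x - f (x + 1)) atTop (𝓝 0) := by
    simpa using hlim.sub (hlim.comp (tendsto_atTop_add_const_right atTop (1 : ℝ) tendsto_id))
  have hstep : ∀ y, 0 < y → f (y + 1) < f y := by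
    intro y hy
    have h1 : f (y + 1) - f (y + 1 + 1) < f y - f (y + 1) :=
      hanti hy (show (0 : ℝ) < y + 1 by positivity) (by linarith)
    have h2 : 0 ≤ f (y + 1) - f (y + 1 + 1) := by
      refine le_of_tendsto hlim1 ?_
      filter_upwards [eventually_gt_atTop (y + 1)] with z hz
      exact (hanti (show (0 : ℝ) < y + 1 by positivity) (show (0 : ℝ) < z by linarith) hz).le
    linarith
  have hseq : Antitone fun k : ℕ => f (x + 1 + k) := by
    refine antitone_nat_of_succ_le fun k => ?_
    have := (hstep (x + 1 + k) (by positivity)).le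
    rw [add_assoc (x + 1) (k : ℝ) 1] at this
    exact_mod_cast this
  have h0 : 0 ≤ f (x + 1) := by
    have := hseq.le_of_tendsto (hlim.comp
      (tendsto_atTop_add_const_left atTop (x + 1) tendsto_natCast_atTop_atTop)) 0
    simpa using this
  exact h0.trans_lt (hstep x hx)

/-! ### Euler-Maclaurin error on a single step -/

/-- The error of the corrected trapezoidal rule for `1 / x` on one step `[x, x + h]`. -/
noncomputable def stepErr (h x : ℝ) : ℝ :=
  (log (x + h) - log x) / h - (1 / x + 1 / (x + h)) / 2 + h / 12 * (1 / x ^ 2 - 1 / (x + h) ^ 2)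

/-- The complement of `stepErr` to the next Euler-Maclaurin correction. -/
noncomputable def stepErr' (h x : ℝ) : ℝ :=
  h ^ 3 / 120 * (1 / x ^ 4 - 1 / (x + h) ^ 4) - stepErr h x

theorem hasDerivAt_one_div_pow (s : ℕ) {x : ℝ} (hx : x ≠ 0) :
    HasDerivAt (fun x : ℝ => 1 / x ^ s) (-(s : ℝ) * (1 / x ^ (s + 1))) x := by
  have := (hasDerivAt_pow s x).fun_inv (pow_ne_zero s hx)
  simp only [one_div]
  refine this.congr_deriv ?_
  rcases s with _ | s
  · simp
  · field_simp
    simp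
    ring

theorem hasDerivAt_one_div_shift_pow (s : ℕ) {x h : ℝ} (hx : x + h ≠ 0) :
    HasDerivAt (fun x : ℝ => 1 / (x + h) ^ s) (-(s : ℝ) * (1 / (x + h) ^ (s + 1))) x :=
  (hasDerivAt_one_div_pow s hx).comp_add_const x h

/-- The first derivative of `stepErr h`. -/
noncomputable def stepErrD (h x : ℝ) : ℝ :=
  (1 / (x + h) - 1 / x) / h + (1 / x ^ 2 + 1 / (x + h) ^ 2) / 2
    - h / 6 * (1 / x ^ 3 - 1 / (x + h) ^ 3)

/-- The second derivative of `stepErr h`. -/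
noncomputable def stepErrDD (h x : ℝ) : ℝ :=
  (1 / x ^ 2 - 1 / (x + h) ^ 2) / h - (1 / x ^ 3 + 1 / (x + h) ^ 3)
    + h / 2 * (1 / x ^ 4 - 1 / (x + h) ^ 4)

theorem hasDerivAt_stepErr {h x : ℝ} (hh : 0 < h) (hx : 0 < x) :
    HasDerivAt (stepErr h) (stepErrD h x) x := by
  have hxh : x + h ≠ 0 := by positivity
  have e1 := hasDerivAt_one_div_pow 1 hx.ne'
  have e2 := hasDerivAt_one_div_pow 2 hx.ne'
  have g1 := hasDerivAt_one_div_shift_pow 1 hxh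
  have g2 := hasDerivAt_one_div_shift_pow 2 hxh
  have l1 := Real.hasDerivAt_log hx.ne'
  have l2 := (Real.hasDerivAt_log hxh).comp_add_const x h
  have := (((l2.sub l1).div_const h).sub ((e1.add g1).div_const 2)).add
    ((e2.sub g2).const_mul (h / 12))
  simp only [pow_one] at this
  refine this.congr_deriv ?_
  simp only [stepErrD, one_div]
  push_cast
  ring

theorem hasDerivAt_stepErrD {h x : ℝ} (hh : 0 < h) (hx : 0 < x) :
    HasDerivAt (stepErrD h) (stepErrDD h x) x := by
  have hxh : x + h ≠ 0 := by positivity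
  have e1 := hasDerivAt_one_div_pow 1 hx.ne'
  have e2 := hasDerivAt_one_div_pow 2 hx.ne'
  have e3 := hasDerivAt_one_div_pow 3 hx.ne'
  have g1 := hasDerivAt_one_div_shift_pow 1 hxh
  have g2 := hasDerivAt_one_div_shift_pow 2 hxh
  have g3 := hasDerivAt_one_div_shift_pow 3 hxh
  have := (((g1.sub e1).div_const h).add ((e2.add g2).div_const 2)).sub
    ((e3.sub g3).const_mul (h / 6))
  simp only [pow_one] at this
  refine this.congr_deriv ?_
  simp only [stepErrDD, one_div]
  push_cast
  ring

theorem stepErrDD_pos {h x : ℝ} (hh : 0 < h) (hx : 0 < x) : 0 < stepErrDD h x := by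
  have : stepErrDD h x = h ^ 4 * (2 * x + h) / (2 * x ^ 4 * (x + h) ^ 4) := by
    unfold stepErrDD
    field_simp
    ring
  rw [this]; positivity

/-- This is the second derivative of `stepErr' h` (the factor `1/6` is `4 · 5 / 120`); over a common
denominator all coefficients of the numerator are positive. -/
theorem stepErrDD_lt {h x : ℝ} (hh : 0 < h) (hx : 0 < x) :
    0 < h ^ 3 / 6 * (1 / x ^ 6 - 1 / (x + h) ^ 6) - stepErrDD h x := by
  have : h ^ 3 / 6 * (1 / x ^ 6 - 1 / (x + h) ^ 6) - stepErrDD h x =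
      h ^ 6 * (8 * x ^ 3 + 12 * h * x ^ 2 + 6 * h ^ 2 * x + h ^ 3) / (6 * x ^ 6 * (x + h) ^ 6) := by
    unfold stepErrDD
    field_simp
    ring
  rw [this]; positivity

theorem tendsto_one_div_shift_pow (s : ℕ) (hs : s ≠ 0) (h : ℝ) :
    Tendsto (fun x : ℝ => 1 / (x + h) ^ s) atTop (𝓝 0) := by
  simp only [one_div]
  exact tendsto_inv_atTop_zero.comp ((tendsto_pow_atTop hs).comp
    (tendsto_atTop_add_const_right atTop h tendsto_id))

theorem tendsto_log_shift_sub (h : ℝ) :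
    Tendsto (fun x : ℝ => log (x + h) - log x) atTop (𝓝 0) := by
  have h1 : Tendsto (fun x : ℝ => log (1 + h * x⁻¹)) atTop (𝓝 0) := by
    have : Tendsto (fun x : ℝ => 1 + h * x⁻¹) atTop (𝓝 1) := by
      simpa using (tendsto_inv_atTop_zero.const_mul h).const_add (1 : ℝ)
    simpa [Function.comp_def] using (continuousAt_log one_ne_zero).tendsto.comp this
  refine h1.congr' ?_
  filter_upwards [eventually_gt_atTop 0, eventually_gt_atTop (-h)] with x hx hxh
  rw [← log_div (by linarith) hx.ne']
  congr 1
  field_simp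

theorem tendsto_stepErr (h : ℝ) : Tendsto (stepErr h) atTop (𝓝 0) := by
  have e1 := tendsto_one_div_shift_pow 1 one_ne_zero 0
  have e2 := tendsto_one_div_shift_pow 2 two_ne_zero 0
  have g1 := tendsto_one_div_shift_pow 1 one_ne_zero h
  have g2 := tendsto_one_div_shift_pow 2 two_ne_zero h
  have := (((tendsto_log_shift_sub h).div_const h).sub ((e1.add g1).div_const 2)).add
    ((e2.sub g2).const_mul (h / 12))
  simp only [add_zero, sub_zero, mul_zero, zero_div, pow_one] at this
  exact this

theorem tendsto_stepErr' (h : ℝ) : Tendsto (stepErr' h) atTop (𝓝 0) := by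
  have e4 := tendsto_one_div_shift_pow 4 four_ne_zero 0
  have g4 := tendsto_one_div_shift_pow 4 four_ne_zero h
  have := ((e4.sub g4).const_mul (h ^ 3 / 120)).sub (tendsto_stepErr h)
  simp only [add_zero, sub_zero, mul_zero] at this
  exact this

theorem stepErr_pos {h x : ℝ} (hh : 0 < h) (hx : 0 < x) : 0 < stepErr h x :=
  pos_of_strictConvex_of_tendsto_zero (fun _ => hasDerivAt_stepErr hh)
    (fun _ => hasDerivAt_stepErrD hh) (fun _ => stepErrDD_pos hh) (tendsto_stepErr h) hx

theorem stepErr_shift_strictAntiOn {h p : ℝ} (hh : 0 < h) (hp : 0 < p) :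
    StrictAntiOn (fun x => stepErr h x - stepErr h (x + p)) (Ioi 0) :=
  strictAntiOn_sub_shift (fun _ => hasDerivAt_stepErr hh)
    (fun _ => hasDerivAt_stepErrD hh) (fun _ => stepErrDD_pos hh) hp

theorem hasDerivAt_stepErr' {h x : ℝ} (hh : 0 < h) (hx : 0 < x) :
    HasDerivAt (stepErr' h)
      (h ^ 3 / 30 * (1 / (x + h) ^ 5 - 1 / x ^ 5) - stepErrD h x) x := by
  have hxh : x + h ≠ 0 := by positivity
  have := (((hasDerivAt_one_div_pow 4 hx.ne').sub (hasDerivAt_one_div_shift_pow 4 hxh)).const_mul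
    (h ^ 3 / 120)).sub (hasDerivAt_stepErr hh hx)
  refine this.congr_deriv ?_
  push_cast
  ring

theorem hasDerivAt_stepErrD' {h x : ℝ} (hh : 0 < h) (hx : 0 < x) :
    HasDerivAt (fun x => h ^ 3 / 30 * (1 / (x + h) ^ 5 - 1 / x ^ 5) - stepErrD h x)
      (h ^ 3 / 6 * (1 / x ^ 6 - 1 / (x + h) ^ 6) - stepErrDD h x) x := by
  have hxh : x + h ≠ 0 := by positivity
  have := (((hasDerivAt_one_div_shift_pow 5 hxh).sub (hasDerivAt_one_div_pow 5 hx.ne')).const_mul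
    (h ^ 3 / 30)).sub (hasDerivAt_stepErrD hh hx)
  refine this.congr_deriv ?_
  push_cast
  ring

theorem stepErr'_pos {h x : ℝ} (hh : 0 < h) (hx : 0 < x) : 0 < stepErr' h x :=
  pos_of_strictConvex_of_tendsto_zero (fun _ => hasDerivAt_stepErr' hh)
    (fun _ => hasDerivAt_stepErrD' hh) (fun _ => stepErrDD_lt hh) (tendsto_stepErr' h) hx

theorem stepErr'_shift_strictAntiOn {h p : ℝ} (hh : 0 < h) (hp : 0 < p) :
    StrictAntiOn (fun x => stepErr' h x - stepErr' h (x + p)) (Ioi 0) :=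
  strictAntiOn_sub_shift (fun _ => hasDerivAt_stepErr' hh)
    (fun _ => hasDerivAt_stepErrD' hh) (fun _ => stepErrDD_lt hh) hp

/-! ### Summation over a progression: the digamma remainder -/

/-- The sum over a progression of a function whose values and complements `g x - g (x + h) - f x`
are nonnegative converges. -/
theorem summable_progression {f g : ℝ → ℝ} {h : ℝ} (hh : 0 < h) (hf : ∀ x, 0 < x → 0 ≤ f x)
    (hfg : ∀ x, 0 < x → f x ≤ g x - g (x + h)) (hg : ∀ x, 0 < x → 0 ≤ g x) {x : ℝ} (hx : 0 < x) :
    Summable (fun m : ℕ => f (x + m * h)) ∧ ∑' m : ℕ, f (x + m * h) ≤ g x := by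
  have h0 : ∀ m : ℕ, 0 ≤ f (x + m * h) := fun m => hf _ (by positivity)
  have hb : ∀ M : ℕ, ∑ m ∈ Finset.range M, f (x + m * h) ≤ g x := by
    intro M
    have : ∑ m ∈ Finset.range M, f (x + m * h) ≤ g x - g (x + M * h) := by
      induction M with
      | zero => simp
      | succ M ih =>
        rw [Finset.sum_range_succ]
        have := hfg (x + M * h) (by positivity)
        rw [show x + M * h + h = x + ((M + 1 : ℕ) : ℝ) * h by push_cast; ring] at this
        linarith
    have := hg (x + M * h) (by positivity)
    linarith
  exact ⟨summable_of_sum_range_le h0 hb, Real.tsum_le_of_sum_range_le h0 hb⟩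

/-- The remainder of the digamma function (with step `h`) after its first asymptotic terms. -/
noncomputable def remainder (h x : ℝ) : ℝ := ∑' m : ℕ, stepErr h (x + m * h)

theorem summable_stepErr_and_le {h x : ℝ} (hh : 0 < h) (hx : 0 < x) :
    Summable (fun m : ℕ => stepErr h (x + m * h)) ∧ remainder h x ≤ h ^ 3 / 120 * (1 / x ^ 4) := by
  refine summable_progression (g := fun x => h ^ 3 / 120 * (1 / x ^ 4)) hh
    (fun x hx => (stepErr_pos hh hx).le) (fun x hx => ?_) (fun x hx => by positivity) hx
  have := stepErr'_pos hh hx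
  unfold stepErr' at this
  linarith

theorem remainder_nonneg {h x : ℝ} (hh : 0 < h) (hx : 0 < x) : 0 ≤ remainder h x :=
  tsum_nonneg fun m => (stepErr_pos hh (by positivity)).le

theorem remainder_sub_shift {h x : ℝ} (hh : 0 < h) (hx : 0 < x) :
    remainder h x - remainder h (x + h) = stepErr h x := by
  have := (summable_stepErr_and_le hh hx).1.tsum_eq_zero_add
  have e : ∀ m : ℕ, x + ((m + 1 : ℕ) : ℝ) * h = x + h + m * h := fun m => by push_cast; ring
  simp only [e] at this
  simp only [Nat.cast_zero, zero_mul, add_zero] at this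
  unfold remainder
  linarith

theorem remainder_shift_strictAntiOn {h p : ℝ} (hh : 0 < h) (hp : 0 < p) :
    StrictAntiOn (fun x => remainder h x - remainder h (x + p)) (Ioi 0) := by
  intro x hx y hy hxy
  have hs : ∀ {x : ℝ}, 0 < x → Summable fun m : ℕ => stepErr h (x + m * h) :=
    fun hx => (summable_stepErr_and_le hh hx).1
  have hx' : (0 : ℝ) < x := hx
  have hy' : (0 : ℝ) < y := hy
  have hxp := hs (show 0 < x + p by positivity)
  have hyp := hs (show 0 < y + p by positivity)
  have hlt : ∀ m : ℕ, stepErr h (y + m * h) - stepErr h (y + p + m * h) <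
      stepErr h (x + m * h) - stepErr h (x + p + m * h) := by
    intro m
    have := stepErr_shift_strictAntiOn hh hp (show (0 : ℝ) < x + m * h by positivity)
      (show (0 : ℝ) < y + m * h by positivity) (by linarith)
    simpa only [add_right_comm] using this
  simp only [remainder]
  rw [← (hs hx').tsum_sub hxp, ← (hs hy').tsum_sub hyp]
  exact Summable.tsum_lt_tsum (fun m => (hlt m).le) (hlt 0) ((hs hy').sub hyp) ((hs hx').sub hxp)

theorem hasSum_telescope {f : ℝ → ℝ} {h : ℝ} (hh : 0 < h) (hlim : Tendsto f atTop (𝓝 0)) (x : ℝ)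
    (hs : Summable fun m : ℕ => f (x + m * h) - f (x + m * h + h)) :
    HasSum (fun m : ℕ => f (x + m * h) - f (x + m * h + h)) (f x) := by
  refine (hs.hasSum_iff_tendsto_nat).2 ?_
  have e : ∀ M : ℕ, ∑ m ∈ Finset.range M, (f (x + m * h) - f (x + m * h + h)) =
      f x - f (x + M * h) := by
    intro M
    induction M with
    | zero => simp
    | succ M ih =>
      rw [Finset.sum_range_succ, ih,
        show x + M * h + h = x + ((M + 1 : ℕ) : ℝ) * h by push_cast; ring]
      ring
  simp only [e]
  have : Tendsto (fun M : ℕ => x + M * h) atTop atTop :=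
    tendsto_atTop_add_const_left _ _ (tendsto_natCast_atTop_atTop.atTop_mul_const hh)
  simpa using (hlim.comp this).const_sub (f x)

/-- The complement of `remainder` to the next term of the asymptotic expansion. -/
noncomputable def remainder' (h x : ℝ) : ℝ := h ^ 3 / 120 * (1 / x ^ 4) - remainder h x

theorem hasSum_stepErr' {h x : ℝ} (hh : 0 < h) (hx : 0 < x) :
    HasSum (fun m : ℕ => stepErr' h (x + m * h)) (remainder' h x) := by
  have hlim : Tendsto (fun x : ℝ => h ^ 3 / 120 * (1 / x ^ 4)) atTop (𝓝 0) := by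
    simpa using (tendsto_one_div_shift_pow 4 four_ne_zero 0).const_mul (h ^ 3 / 120)
  have h1 : Summable fun m : ℕ => h ^ 3 / 120 * (1 / (x + m * h) ^ 4) -
      h ^ 3 / 120 * (1 / (x + m * h + h) ^ 4) := by
    refine (summable_progression (f := fun x => h ^ 3 / 120 * (1 / x ^ 4) -
      h ^ 3 / 120 * (1 / (x + h) ^ 4)) (g := fun x => h ^ 3 / 120 * (1 / x ^ 4)) hh
      (fun x hx => ?_) (fun x hx => le_rfl) (fun x hx => by positivity) hx).1
    -- The telescoping increment is `stepErr + stepErr'`, hence nonnegative.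
    have h1 := stepErr'_pos hh hx
    have h2 := stepErr_pos hh hx
    unfold stepErr' at h1
    linarith
  have := (hasSum_telescope hh hlim x h1).sub (summable_stepErr_and_le hh hx).1.hasSum
  refine this.congr_fun ?_
  intro m
  simp only [stepErr']
  ring

theorem remainder'_shift_strictAntiOn {h p : ℝ} (hh : 0 < h) (hp : 0 < p) :
    StrictAntiOn (fun x => remainder' h x - remainder' h (x + p)) (Ioi 0) := by
  intro x hx y hy hxy
  have hx' : (0 : ℝ) < x := hx
  have hy' : (0 : ℝ) < y := hy
  have sx := (hasSum_stepErr' hh hx').sub (hasSum_stepErr' hh (show 0 < x + p by positivity))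
  have sy := (hasSum_stepErr' hh hy').sub (hasSum_stepErr' hh (show 0 < y + p by positivity))
  have hlt : ∀ m : ℕ, stepErr' h (y + m * h) - stepErr' h (y + p + m * h) <
      stepErr' h (x + m * h) - stepErr' h (x + p + m * h) := by
    intro m
    have := stepErr'_shift_strictAntiOn hh hp (show (0 : ℝ) < x + m * h by positivity)
      (show (0 : ℝ) < y + m * h by positivity) (by linarith)
    simpa only [add_right_comm] using this
  exact hasSum_lt (fun m => (hlt m).le) (hlt 0) sy sx

/-! ### Alternating sums over shifts by π -/

/-- The conditions under which `altSum` is well behaved. -/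
structure AltConvex (f : ℝ → ℝ) : Prop where
  anti : StrictAntiOn (fun x => f x - f (x + π)) (Ioi 0)
  lim : Tendsto f atTop (𝓝 0)
  nonneg : ∀ x, 0 < x → 0 ≤ f x

/-- The alternating sum `f x - f (x + π) + f (x + 2π) - ⋯`, with consecutive terms paired. -/
noncomputable def altSum (f : ℝ → ℝ) (x : ℝ) : ℝ :=
  ∑' i : ℕ, (f (x + i * (2 * π)) - f (x + i * (2 * π) + π))

theorem AltConvex.sub_shift_nonneg {f : ℝ → ℝ} (hf : AltConvex f) {x : ℝ} (hx : 0 < x) :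
    0 ≤ f x - f (x + π) := by
  have h1 : Tendsto (fun x => f x - f (x + π)) atTop (𝓝 0) := by
    simpa using hf.lim.sub (hf.lim.comp (tendsto_atTop_add_const_right atTop π tendsto_id))
  refine le_of_tendsto h1 ?_
  filter_upwards [eventually_gt_atTop x] with z hz
  exact (hf.anti hx (show (0 : ℝ) < z by linarith) hz).le

theorem AltConvex.summable {f : ℝ → ℝ} (hf : AltConvex f) {x : ℝ} (hx : 0 < x) :
    Summable fun i : ℕ => f (x + i * (2 * π)) - f (x + i * (2 * π) + π) := by
  refine (summable_progression (f := fun x => f x - f (x + π)) (g := f) two_pi_pos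
    (fun x hx => hf.sub_shift_nonneg hx) (fun x hx => ?_) hf.nonneg hx).1
  -- Adding the nonnegative difference at `x + π` bounds the pair by `f x - f (x + 2π)`, which
  -- telescopes.
  have := hf.sub_shift_nonneg (show 0 < x + π by positivity)
  rw [add_assoc, ← two_mul] at this
  linarith

theorem AltConvex.hasSum {f : ℝ → ℝ} (hf : AltConvex f) {x : ℝ} (hx : 0 < x) :
    HasSum (fun i : ℕ => f (x + i * (2 * π)) - f (x + i * (2 * π) + π)) (altSum f x) :=
  (hf.summable hx).hasSum

theorem AltConvex.altSum_strictAntiOn {f : ℝ → ℝ} (hf : AltConvex f) :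
    StrictAntiOn (altSum f) (Ioi 0) := by
  intro x hx y hy hxy
  have hx' : (0 : ℝ) < x := hx
  have hy' : (0 : ℝ) < y := hy
  have hlt : ∀ i : ℕ, f (y + i * (2 * π)) - f (y + i * (2 * π) + π) <
      f (x + i * (2 * π)) - f (x + i * (2 * π) + π) := fun i =>
    hf.anti (show (0 : ℝ) < x + i * (2 * π) by positivity)
      (show (0 : ℝ) < y + i * (2 * π) by positivity) (by linarith)
  exact hasSum_lt (fun i => (hlt i).le) (hlt 0) (hf.hasSum hy') (hf.hasSum hx')

theorem AltConvex.altSum_add_altSum_shift {f : ℝ → ℝ} (hf : AltConvex f) {x : ℝ} (hx : 0 < x) :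
    altSum f x + altSum f (x + π) = f x := by
  have h1 := (hf.hasSum hx).add (hf.hasSum (show 0 < x + π by positivity))
  have e : ∀ i : ℕ, f (x + i * (2 * π)) - f (x + i * (2 * π) + π) +
      (f (x + π + i * (2 * π)) - f (x + π + i * (2 * π) + π)) =
      f (x + i * (2 * π)) - f (x + i * (2 * π) + 2 * π) := by
    intro i
    rw [show x + π + i * (2 * π) + π = x + i * (2 * π) + 2 * π by ring,
      show x + π + i * (2 * π) = x + i * (2 * π) + π by ring]
    ring
  simp only [e] at h1
  exact h1.unique (hasSum_telescope two_pi_pos hf.lim x h1.summable)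

theorem altConvex_one_div_pow {s : ℕ} (hs : s ≠ 0) : AltConvex fun x => 1 / x ^ s where
  anti := by
    refine strictAntiOn_sub_shift (fun x hx => hasDerivAt_one_div_pow s hx.ne')
      (fun x hx => (hasDerivAt_one_div_pow (s + 1) hx.ne').const_mul _) (fun x hx => ?_) pi_pos
    have : 0 < s := Nat.pos_of_ne_zero hs
    rw [neg_mul, neg_mul, mul_neg, neg_neg]
    positivity
  lim := by simpa using tendsto_one_div_shift_pow s hs 0
  nonneg := fun x hx => by positivity

theorem altConvex_remainder {h : ℝ} (hh : 0 < h) : AltConvex (remainder h) where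
  anti := remainder_shift_strictAntiOn hh pi_pos
  lim := by
    refine tendsto_of_tendsto_of_tendsto_of_le_of_le' tendsto_const_nhds
      (by simpa using (tendsto_one_div_shift_pow 4 four_ne_zero 0).const_mul (h ^ 3 / 120))
      ?_ ?_
    · filter_upwards [eventually_gt_atTop 0] with x hx using remainder_nonneg hh hx
    · filter_upwards [eventually_gt_atTop 0] with x hx
      simpa using (summable_stepErr_and_le hh hx).2
  nonneg := fun x hx => remainder_nonneg hh hx

theorem altConvex_remainder' {h : ℝ} (hh : 0 < h) : AltConvex (remainder' h) where
  anti := remainder'_shift_strictAntiOn hh pi_pos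
  lim := by
    have h1 : Tendsto (fun x : ℝ => h ^ 3 / 120 * (1 / x ^ 4)) atTop (𝓝 0) := by
      simpa using (tendsto_one_div_shift_pow 4 four_ne_zero 0).const_mul (h ^ 3 / 120)
    rw [← sub_zero (0 : ℝ)]
    exact h1.sub (altConvex_remainder hh).lim
  nonneg := fun x hx => (hasSum_stepErr' hh hx).nonneg fun m => (stepErr'_pos hh (by positivity)).le

/-! ### Alternating power and logarithm series -/

/-- The alternating sum of `1 / (x + jπ) ^ s`. -/
noncomputable def altPow (s : ℕ) (x : ℝ) : ℝ := altSum (fun x => 1 / x ^ s) x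

/-- Termwise differentiation on `(x/2, ∞)`: paired terms decrease, so their values at `x/2` form a
summable majorant. -/
theorem hasDerivAt_altPow {s : ℕ} (hs : s ≠ 0) {x : ℝ} (hx : 0 < x) :
    HasDerivAt (altPow s) (-(s : ℝ) * altPow (s + 1) x) x := by
  have h2 := altConvex_one_div_pow (Nat.succ_ne_zero s)
  have hx2 : 0 < x / 2 := by positivity
  have := hasDerivAt_tsum_of_isPreconnected (t := Ioi (x / 2)) (y := x) (y₀ := x)
    (g := fun (i : ℕ) (x : ℝ) => 1 / (x + i * (2 * π)) ^ s - 1 / (x + i * (2 * π) + π) ^ s)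
    (g' := fun (i : ℕ) (x : ℝ) => -(s : ℝ) *
      (1 / (x + i * (2 * π)) ^ (s + 1) - 1 / (x + i * (2 * π) + π) ^ (s + 1)))
    ((h2.summable hx2).mul_left (s : ℝ)) isOpen_Ioi isPreconnected_Ioi ?_ ?_
    (show x / 2 < x by linarith) ((altConvex_one_div_pow hs).summable hx)
    (show x / 2 < x by linarith)
  · rw [tsum_mul_left] at this
    exact this
  · intro i y hy
    have hy' : 0 < y := lt_trans hx2 hy
    have a1 := hasDerivAt_one_div_shift_pow s (x := y) (h := i * (2 * π)) (by positivity)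
    have a2 := hasDerivAt_one_div_shift_pow s (x := y) (h := i * (2 * π) + π) (by positivity)
    simp only [← add_assoc] at a2
    exact (a1.sub a2).congr_deriv (by ring)
  · intro i y hy
    have hy' : 0 < y := lt_trans hx2 hy
    rw [norm_mul, norm_neg, norm_natCast, Real.norm_of_nonneg
      (h2.sub_shift_nonneg (show 0 < y + i * (2 * π) by positivity))]
    refine mul_le_mul_of_nonneg_left ?_ (Nat.cast_nonneg s)
    exact (h2.anti (show 0 < x / 2 + i * (2 * π) by positivity)
      (show 0 < y + i * (2 * π) by positivity) (by simpa using hy)).le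

/-- The terms of the series `altLog`. -/
noncomputable def altLogTerm (i : ℕ) (x : ℝ) : ℝ :=
  log (x + i * (2 * π)) - log (x + i * (2 * π) + π)
    - (log (π / 2 + i * (2 * π)) - log (π / 2 + i * (2 * π) + π))

/-- The alternating sum of `log (x + jπ)`, normalized to vanish at `π / 2`. -/
noncomputable def altLog (x : ℝ) : ℝ := ∑' i : ℕ, altLogTerm i x

theorem hasDerivAt_altLogTerm (i : ℕ) {x : ℝ} (hx : 0 < x) :
    HasDerivAt (altLogTerm i)
      (1 / (x + i * (2 * π)) ^ 1 - 1 / (x + i * (2 * π) + π) ^ 1) x := by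
  have a1 := (hasDerivAt_log (x := x + i * (2 * π)) (by positivity)).comp_add_const x (i * (2 * π))
  have a2 := (hasDerivAt_log (x := x + (i * (2 * π) + π)) (by positivity)).comp_add_const x
    (i * (2 * π) + π)
  have := (a1.sub a2).sub_const
    (log (π / 2 + i * (2 * π)) - log (π / 2 + i * (2 * π) + π))
  simp only [← add_assoc] at this
  simp only [pow_one, one_div]
  exact this

theorem norm_altLogTerm_deriv_le {ε : ℝ} (hε : 0 < ε) (i : ℕ) (y : ℝ) (hy : y ∈ Ioi ε) :
    ‖1 / (y + i * (2 * π)) ^ 1 - 1 / (y + i * (2 * π) + π) ^ 1‖ ≤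
      1 / (ε + i * (2 * π)) ^ 1 - 1 / (ε + i * (2 * π) + π) ^ 1 := by
  have h2 := altConvex_one_div_pow one_ne_zero
  have hy' : 0 < y := lt_trans hε hy
  rw [Real.norm_of_nonneg (h2.sub_shift_nonneg (show 0 < y + i * (2 * π) by positivity))]
  exact (h2.anti (show 0 < ε + i * (2 * π) by positivity)
    (show 0 < y + i * (2 * π) by positivity) (by simpa using hy)).le

/-- The bare pairs of logarithms behave like `-1/(2i)` and diverge. After normalization all terms
vanish at `π/2`, and uniform summability of the derivatives carries convergence from there along the
ray `(ε, ∞)`. -/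
theorem summable_altLogTerm {x : ℝ} (hx : 0 < x) : Summable fun i => altLogTerm i x := by
  obtain ⟨ε, hε, hεx⟩ := exists_between (lt_min hx (half_pos pi_pos))
  have h2 := altConvex_one_div_pow one_ne_zero
  refine summable_of_summable_hasDerivAt_of_isPreconnected (h2.summable hε) isOpen_Ioi
    isPreconnected_Ioi (fun i y hy => hasDerivAt_altLogTerm i (lt_trans hε hy))
    (norm_altLogTerm_deriv_le hε) (lt_of_lt_of_le hεx (min_le_right _ _)) ?_
    (lt_of_lt_of_le hεx (min_le_left _ _))
  simp [altLogTerm, summable_zero]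

theorem hasDerivAt_altLog {x : ℝ} (hx : 0 < x) : HasDerivAt altLog (altPow 1 x) x := by
  have hx2 : 0 < x / 2 := by positivity
  exact hasDerivAt_tsum_of_isPreconnected ((altConvex_one_div_pow one_ne_zero).summable hx2)
    isOpen_Ioi isPreconnected_Ioi (fun i y hy => hasDerivAt_altLogTerm i (lt_trans hx2 hy))
    (norm_altLogTerm_deriv_le hx2) (show x / 2 < x by linarith) (summable_altLogTerm hx)
    (show x / 2 < x by linarith)

theorem eq_of_hasDerivAt_eq {f g f' : ℝ → ℝ} {s : Set ℝ} (hs : IsOpen s) (hs' : IsPreconnected s)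
    (hf : ∀ x ∈ s, HasDerivAt f (f' x) x) (hg : ∀ x ∈ s, HasDerivAt g (f' x) x)
    {x y : ℝ} (hx : x ∈ s) (hy : y ∈ s) : f x - g x = f y - g y := by
  refine hs.is_const_of_deriv_eq_zero (𝕜 := ℝ) (f := fun x => f x - g x) hs' (fun z hz =>
    ((hf z hz).sub (hg z hz)).differentiableAt.differentiableWithinAt) (fun z hz => ?_) hx hy
  rw [((hf z hz).fun_sub (hg z hz)).deriv, sub_self]
  rfl

/-- Both sides have derivative `1/x`. The value of `C` is irrelevant, as it later cancels between
two endpoints. -/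
theorem exists_altLog_add_altLog_shift :
    ∃ C : ℝ, ∀ x, 0 < x → altLog x + altLog (x + π) = log x + C := by
  refine ⟨altLog 1 + altLog (1 + π) - log 1, fun x hx => ?_⟩
  have := eq_of_hasDerivAt_eq (f := fun x => altLog x + altLog (x + π)) (g := log)
    (f' := fun x => x⁻¹) isOpen_Ioi isPreconnected_Ioi (fun x (hx : 0 < x) => ?_)
    (fun x (hx : 0 < x) => hasDerivAt_log hx.ne') (show x ∈ Ioi 0 from hx)
    (show (1 : ℝ) ∈ Ioi 0 by simp)
  · linarith
  · refine ((hasDerivAt_altLog hx).add ((hasDerivAt_altLog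
      (show 0 < x + π by positivity)).comp_add_const x π)).congr_deriv ?_
    simpa [altPow] using (altConvex_one_div_pow one_ne_zero).altSum_add_altSum_shift hx

/-! ### Partial fractions of cotangent and cosecant -/

theorem tendsto_sum_cot {x : ℝ} (hx : ∀ k : ℤ, x ≠ k) :
    Tendsto (fun n : ℕ => ∑ j ∈ Finset.range n, (1 / (x - (j + 1)) + 1 / (x + (j + 1)))) atTop
      (𝓝 (π * cot (π * x) - 1 / x)) := by
  have hz : (x : ℂ) ∈ Complex.integerComplement := by
    rintro ⟨k, hk⟩
    exact hx k (by exact_mod_cast hk.symm)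
  have := tendsto_logDeriv_euler_cot_sub hz
  rw [← Filter.tendsto_ofReal_iff]
  simpa [cotTerm] using this

theorem tendsto_sum_cot_scaled {x d : ℝ} (hd : 0 < d) (hx : ∀ k : ℤ, x ≠ k * d) :
    Tendsto (fun n : ℕ => ∑ j ∈ Finset.range n, (1 / (x - (j + 1) * d) + 1 / (x + (j + 1) * d)))
      atTop (𝓝 (π / d * cot (π * x / d) - 1 / x)) := by
  have h1 := (tendsto_sum_cot (x := x / d) fun k hk => hx k (by field_simp at hk; linarith)).const_mul
    (1 / d)
  convert h1 using 2
  · rw [Finset.mul_sum]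
    refine Finset.sum_congr rfl fun j _ => ?_
    rw [show x / d - (j + 1) = (x - (j + 1) * d) / d by field_simp,
      show x / d + (j + 1) = (x + (j + 1) * d) / d by field_simp]
    simp only [one_div, inv_div]
    field_simp
  · rw [show π * x / d = π * (x / d) by ring]
    field_simp

theorem csc_eq_cot_add_cot {x : ℝ} (hx : x ∈ Ioo 0 π) :
    csc x = (cot (x / 2) + cot ((π - x) / 2)) / 2 := by
  have h1 : 0 < sin (x / 2) := sin_pos_of_pos_of_lt_pi (by linarith [hx.1]) (by linarith [hx.1, hx.2])
  have h2 : 0 < cos (x / 2) := cos_pos_of_mem_Ioo ⟨by linarith [hx.1, pi_pos], by linarith [hx.2]⟩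
  rw [csc, cot_eq_cos_div_sin, cot_eq_cos_div_sin, show (π - x) / 2 = π / 2 - x / 2 by ring,
    cos_pi_div_two_sub, sin_pi_div_two_sub]
  conv_lhs => rw [show x = 2 * (x / 2) by ring, sin_two_mul]
  have := sin_sq_add_cos_sq (x / 2)
  field_simp
  linarith

/-- The half-angle identity reduces this to two cotangent expansions with period `2π`, at `x` and at
`π - x`, whose terms regroup into the pairs of `altSum`. -/
theorem csc_eq_altPow {x : ℝ} (hx : x ∈ Ioo 0 π) : csc x = altPow 1 x + altPow 1 (π - x) := by
  have key : ∀ x ∈ Ioo 0 π, ∀ k : ℤ, x ≠ k * (2 * π) := by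
    intro x hx k hk
    have h1 := hx.1
    have h2 := hx.2
    rw [hk] at h1 h2
    have hp := pi_pos
    have h3 : (0 : ℝ) < k := by
      by_contra! h
      nlinarith
    have h4 : (1 : ℝ) ≤ k := by exact_mod_cast h3
    nlinarith
  have hx' : π - x ∈ Ioo 0 π := ⟨by linarith [hx.2], by linarith [hx.1]⟩
  have t1 := tendsto_sum_cot_scaled two_pi_pos (key x hx)
  have t2 := tendsto_sum_cot_scaled two_pi_pos (key _ hx')
  have c1 := (altConvex_one_div_pow one_ne_zero).hasSum hx.1
  have c2 := (altConvex_one_div_pow one_ne_zero).hasSum hx'.1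
  have c3 := (c1.add c2).tendsto_sum_nat
  have z : ∀ x : ℝ, Tendsto (fun n : ℕ => 1 / (x + n * (2 * π))) atTop (𝓝 0) := by
    intro x
    have : Tendsto (fun n : ℕ => x + n * (2 * π)) atTop atTop :=
      tendsto_atTop_add_const_left _ _ (tendsto_natCast_atTop_atTop.atTop_mul_const two_pi_pos)
    simpa [Function.comp_def] using tendsto_inv_atTop_zero.comp this
  -- The cotangent sums lack the terms `1/x` and `1/(π - x)` and reach one term further than the
  -- paired sums; the extra terms tend to `0`.
  have lim := (c3.add (((z x).sub_const (1 / x)).add ((z (π - x)).sub_const (1 / (π - x)))))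
  have := tendsto_nhds_unique ((t1.add t2).congr fun n => ?_) lim
  · rw [csc_eq_cot_add_cot hx]
    unfold altPow
    rw [show π * x / (2 * π) = x / 2 by field_simp,
      show π * (π - x) / (2 * π) = (π - x) / 2 by field_simp,
      show π / (2 * π) = 1 / 2 by field_simp] at this
    linarith
  · induction n with
    | zero => simp
    | succ n ih =>
      rw [Finset.sum_range_succ, Finset.sum_range_succ, Finset.sum_range_succ]
      push_cast
      rw [show x - (n + 1) * (2 * π) = -(π - x + n * (2 * π) + π) by ring,
        show π - x - (n + 1) * (2 * π) = -(x + n * (2 * π) + π) by ring, one_div_neg_eq_neg_one_div,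
        one_div_neg_eq_neg_one_div]
      simp only [pow_one] at ih ⊢
      linarith

/-! ### Derivatives and primitive of the cosecant expansion -/

theorem hasDerivAt_altPow_reflect {s : ℕ} (hs : s ≠ 0) {x : ℝ} (hx : x < π) :
    HasDerivAt (fun x => altPow s (π - x)) (s * altPow (s + 1) (π - x)) x := by
  have := HasDerivAt.comp_const_sub π x (hasDerivAt_altPow hs (show 0 < π - x by linarith))
  exact this.congr_deriv (by ring)

theorem sin_pos_of_mem {x : ℝ} (hx : x ∈ Ioo 0 π) : 0 < sin x := sin_pos_of_pos_of_lt_pi hx.1 hx.2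

theorem hasDerivAt_unique_of_eqOn {f g : ℝ → ℝ} {f' g' x : ℝ} (hfg : EqOn f g (Ioo 0 π))
    (hx : x ∈ Ioo 0 π) (hf : HasDerivAt f f' x) (hg : HasDerivAt g g' x) : f' = g' :=
  hf.unique (hg.congr_of_eventuallyEq (hfg.eventuallyEq_of_mem (isOpen_Ioo.mem_nhds hx)))

/-- The first of three successive differentiations of `csc_eq_altPow`; the first and third give the
brackets in the coefficients of `1/n` and `1/n³`. -/
theorem cos_div_sin_sq_eq {x : ℝ} (hx : x ∈ Ioo 0 π) :
    cos x / sin x ^ 2 = altPow 2 x - altPow 2 (π - x) := by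
  have h0 := (sin_pos_of_mem hx).ne'
  have d1 : HasDerivAt (fun x => (sin x)⁻¹) (-cos x / sin x ^ 2) x := (hasDerivAt_sin x).fun_inv h0
  have d2 := (hasDerivAt_altPow one_ne_zero hx.1).add (hasDerivAt_altPow_reflect one_ne_zero hx.2)
  have := hasDerivAt_unique_of_eqOn (fun y hy => ?_) hx d1 d2
  · rw [neg_div] at this
    push_cast at this
    linarith
  · simpa [csc] using csc_eq_altPow hy

theorem two_sub_sin_sq_div_eq {x : ℝ} (hx : x ∈ Ioo 0 π) :
    (2 - sin x ^ 2) / sin x ^ 3 = 2 * (altPow 3 x + altPow 3 (π - x)) := by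
  have h0 := (sin_pos_of_mem hx).ne'
  have d1 := (hasDerivAt_cos x).fun_div ((hasDerivAt_sin x).fun_pow 2) (pow_ne_zero 2 h0)
  have d2 := (hasDerivAt_altPow two_ne_zero hx.1).sub (hasDerivAt_altPow_reflect two_ne_zero hx.2)
  have := hasDerivAt_unique_of_eqOn (fun y hy => cos_div_sin_sq_eq hy) hx d1 d2
  have e : (2 - sin x ^ 2) / sin x ^ 3 =
      -((-sin x * sin x ^ 2 - cos x * (((2 : ℕ) : ℝ) * sin x ^ (2 - 1) * cos x))
        / (sin x ^ 2) ^ 2) := by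
    have := sin_sq_add_cos_sq x
    field_simp
    norm_num
    linear_combination (-2) * sin x * this
  rw [e, this]
  push_cast
  ring

theorem cos_mul_six_sub_div_eq {x : ℝ} (hx : x ∈ Ioo 0 π) :
    cos x * (6 - sin x ^ 2) / sin x ^ 4 = 6 * (altPow 4 x - altPow 4 (π - x)) := by
  have h0 := (sin_pos_of_mem hx).ne'
  have d1 := (((hasDerivAt_sin x).fun_pow 2).const_sub 2).fun_div ((hasDerivAt_sin x).fun_pow 3)
    (pow_ne_zero 3 h0)
  have d2 := ((hasDerivAt_altPow three_ne_zero hx.1).add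
    (hasDerivAt_altPow_reflect three_ne_zero hx.2)).const_mul 2
  have := hasDerivAt_unique_of_eqOn (fun y hy => two_sub_sin_sq_div_eq hy) hx d1 d2
  have e : cos x * (6 - sin x ^ 2) / sin x ^ 4 =
      -((-(((2 : ℕ) : ℝ) * sin x ^ (2 - 1) * cos x) * sin x ^ 3 -
        (2 - sin x ^ 2) * (((3 : ℕ) : ℝ) * sin x ^ (3 - 1) * cos x)) / (sin x ^ 3) ^ 2) := by
    field_simp
    norm_num
    ring
  rw [e, this]
  push_cast
  ring

theorem csc_mul_cot_eq {x : ℝ} (hx : x ∈ Ioo 0 π) :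
    csc x * cot x = altPow 2 x - altPow 2 (π - x) := by
  have h0 := (sin_pos_of_mem hx).ne'
  rw [← cos_div_sin_sq_eq hx, csc, cot_eq_cos_div_sin]
  field_simp

theorem csc_mul_cot_cube_add_eq {x : ℝ} (hx : x ∈ Ioo 0 π) :
    csc x * cot x ^ 3 + 5 * csc x ^ 3 * cot x = 6 * (altPow 4 x - altPow 4 (π - x)) := by
  have h0 := (sin_pos_of_mem hx).ne'
  rw [← cos_mul_six_sub_div_eq hx, csc, cot_eq_cos_div_sin]
  have := sin_sq_add_cos_sq x
  field_simp
  linear_combination cos x * this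

/-- Both sides have derivative `csc` and vanish at `π/2`. -/
theorem log_tan_half_eq {x : ℝ} (hx : x ∈ Ioo 0 π) :
    log (tan (x / 2)) = altLog x - altLog (π - x) := by
  have hm : π / 2 ∈ Ioo 0 π := ⟨by positivity, by linarith [pi_pos]⟩
  have := eq_of_hasDerivAt_eq (f := fun x => log (tan (x / 2)))
    (g := fun x => altLog x - altLog (π - x)) (f' := csc) isOpen_Ioo isPreconnected_Ioo
    (fun y hy => ?_) (fun y hy => ?_) hx hm
  · simp only [show π - π / 2 = π / 2 by ring, show π / 2 / 2 = π / 4 by ring, tan_pi_div_four,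
      log_one, sub_self] at this
    linarith
  · have h1 : 0 < sin (y / 2) :=
      sin_pos_of_pos_of_lt_pi (by linarith [hy.1]) (by linarith [hy.1, hy.2])
    have h2 : 0 < cos (y / 2) :=
      cos_pos_of_mem_Ioo ⟨by linarith [hy.1, pi_pos], by linarith [hy.2]⟩
    have ht : tan (y / 2) ≠ 0 := by rw [tan_eq_sin_div_cos]; positivity
    have d : HasDerivAt (fun y : ℝ => y / 2) (1 / 2) y := (hasDerivAt_id y).div_const 2
    have dt : HasDerivAt (fun y => tan (y / 2)) (1 / cos (y / 2) ^ 2 * (1 / 2)) y :=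
      HasDerivAt.comp (h₂ := tan) y (hasDerivAt_tan h2.ne') d
    refine (dt.log ht).congr_deriv ?_
    rw [csc, tan_eq_sin_div_cos]
    conv_rhs => rw [show y = 2 * (y / 2) by ring, sin_two_mul]
    field_simp
  · have := (hasDerivAt_altLog hy.1).sub
      (HasDerivAt.comp_const_sub π y (hasDerivAt_altLog (show 0 < π - y by linarith [hy.2])))
    exact this.congr_deriv (by rw [csc_eq_altPow hy]; ring)

/-! ### Digamma with step h and its reflection formula -/

/-- The digamma function with step `h`, up to an additive constant. -/
noncomputable def stepDigamma (h x : ℝ) : ℝ :=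
  log x / h - 1 / x / 2 - h / 12 * (1 / x ^ 2) + remainder h x

theorem stepDigamma_shift {h x : ℝ} (hh : 0 < h) (hx : 0 < x) :
    stepDigamma h (x + h) - stepDigamma h x = 1 / x := by
  have := remainder_sub_shift hh hx
  unfold stepErr at this
  unfold stepDigamma
  rw [sub_div] at this
  linarith

theorem tendsto_stepDigamma_sub {h : ℝ} (hh : 0 < h) (c : ℝ) :
    Tendsto (fun y => stepDigamma h (y + c) - stepDigamma h (y - c)) atTop (𝓝 0) := by
  have aux : ∀ c, Tendsto (fun y => stepDigamma h (y + c) - log y / h) atTop (𝓝 0) := by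
    intro c
    have e1 := (tendsto_one_div_shift_pow 1 one_ne_zero c).div_const 2
    have e2 := (tendsto_one_div_shift_pow 2 two_ne_zero c).const_mul (h / 12)
    have e3 := (altConvex_remainder hh).lim.comp (tendsto_atTop_add_const_right atTop c tendsto_id)
    have := ((((tendsto_log_shift_sub c).div_const h).sub e1).sub e2).add e3
    simp only [zero_div, mul_zero, sub_zero, add_zero] at this
    refine this.congr fun y => ?_
    simp only [stepDigamma, Function.comp_apply, id, pow_one]
    ring
  have := (aux c).sub (aux (-c))
  rw [sub_zero] at this
  refine this.congr fun y => ?_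
  rw [← sub_eq_add_neg]
  ring

/-- A finite reflection formula. In the symmetric cotangent series the terms `1/(c + jh)`, and the
terms `1/(c - jh)` with `j ≥ n`, telescope through `stepDigamma`; the far endpoints cancel in the
limit. -/
theorem sum_one_div_sub_eq {h c : ℝ} {n : ℕ} (hh : 0 < h) (hn : 1 ≤ n) (hc : 0 < c)
    (hcn : c < n * h) (hne : ∀ k : ℤ, c ≠ k * h) :
    ∑ l ∈ Finset.Ico 1 n, 1 / (c - l * h) =
      π / h * cot (π * c / h) + stepDigamma h c - stepDigamma h (n * h - c) := by
  -- Starting with `n - 1` terms keeps in one block all `c - jh` whose sign is unknown; from `j = n`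
  -- on, `jh - c` is positive.
  have t1 := (tendsto_add_atTop_iff_nat (n - 1)).2 (tendsto_sum_cot_scaled hh hne)
  have t2 : Tendsto (fun m : ℕ => stepDigamma h ((n + m) * h + c) - stepDigamma h ((n + m) * h - c))
      atTop (𝓝 0) := by
    refine (tendsto_stepDigamma_sub hh c).comp ?_
    exact (tendsto_atTop_add_const_left _ _ tendsto_natCast_atTop_atTop).atTop_mul_const hh
  have t3 := t2.const_add (∑ l ∈ Finset.Ico 1 n, 1 / (c - l * h) + stepDigamma h (n * h - c)
    - stepDigamma h c - 1 / c)
  have := tendsto_nhds_unique (t1.congr fun m => ?_) t3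
  · linarith
  · induction m with
    | zero =>
      have b : ∀ N : ℕ, ∑ j ∈ Finset.range N, 1 / (c + (j + 1) * h) =
          stepDigamma h ((N + 1) * h + c) - stepDigamma h c - 1 / c := by
        intro N
        induction N with
        | zero =>
          have := stepDigamma_shift hh hc
          simp only [Finset.range_zero, Finset.sum_empty, Nat.cast_zero, zero_add, one_mul]
          rw [add_comm h c]
          linarith
        | succ N ih =>
          have := stepDigamma_shift hh (show 0 < c + (N + 1) * h by positivity)
          rw [Finset.sum_range_succ, ih, ← this]
          push_cast
          rw [show c + (N + 1) * h + h = (N + 1 + 1) * h + c by ring,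
            show c + (N + 1) * h = (N + 1) * h + c by ring]
          ring
      have hcast : ((n - 1 : ℕ) : ℝ) + 1 = n := by
        rw [Nat.cast_sub hn]; ring
      rw [zero_add, Finset.sum_add_distrib, b (n - 1), hcast, Finset.sum_Ico_eq_sum_range]
      push_cast
      simp only [add_zero, add_comm (1 : ℝ)]
      ring
    | succ m ih =>
      rw [show m + 1 + (n - 1) = m + (n - 1) + 1 by ring, Finset.sum_range_succ, ih]
      have hcast : ((m + (n - 1) : ℕ) : ℝ) + 1 = n + m := by
        push_cast [Nat.cast_sub hn]; ring
      rw [hcast]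
      push_cast
      have hp : 0 < (n + m) * h - c := by
        have : 0 ≤ m * h := by positivity
        linarith
      have s1 := stepDigamma_shift hh (show 0 < (n + m) * h + c by positivity)
      have s2 := stepDigamma_shift hh hp
      rw [show c - (n + m) * h = -((n + m) * h - c) by ring, one_div_neg_eq_neg_one_div, ← s2,
        add_comm c, ← s1, show (n + m) * h + c + h = (n + (m + 1)) * h + c by ring,
        show (n + m) * h - c + h = (n + (m + 1)) * h - c by ring]
      ring

/-! ### The alternating digamma and the sum across the pole -/

/-- A primitive of `altPow 1` for the difference operator of step `h`. -/
noncomputable def altDigamma (h x : ℝ) : ℝ :=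
  altLog x / h - altPow 1 x / 2 - h / 12 * altPow 2 x + altSum (remainder h) x

theorem altDigamma_shift {h x : ℝ} (hh : 0 < h) (hx : 0 < x) :
    altDigamma h (x + h) - altDigamma h x = altPow 1 x := by
  have hxh : 0 < x + h := by positivity
  have p1 := (altConvex_one_div_pow one_ne_zero).hasSum hx
  have p1' := (altConvex_one_div_pow one_ne_zero).hasSum hxh
  have p2 := (altConvex_one_div_pow two_ne_zero).hasSum hx
  have p2' := (altConvex_one_div_pow two_ne_zero).hasSum hxh
  have r := (altConvex_remainder hh).hasSum hx
  have r' := (altConvex_remainder hh).hasSum hxh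
  have l := (summable_altLogTerm hx).hasSum
  have l' := (summable_altLogTerm hxh).hasSum
  have lhs := (r.sub r')
  have rhs := (((l'.sub l).div_const h).sub ((p1.add p1').div_const 2)).add
    ((p2.sub p2').mul_left (h / 12))
  have := lhs.unique (rhs.congr_fun fun i => ?_)
  · unfold altDigamma altLog altPow
    rw [sub_div] at this
    linarith
  · have s1 := remainder_sub_shift hh (show 0 < x + i * (2 * π) by positivity)
    have s2 := remainder_sub_shift hh (show 0 < x + i * (2 * π) + π by positivity)
    unfold stepErr at s1 s2
    unfold altLogTerm
    rw [show x + h + i * (2 * π) = x + i * (2 * π) + h by ring,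
      show x + i * (2 * π) + h + π = x + i * (2 * π) + π + h by ring]
    simp only [pow_one]
    linear_combination s1 - s2

theorem exists_altDigamma_add_shift {h : ℝ} (hh : 0 < h) :
    ∃ C : ℝ, ∀ x, 0 < x → altDigamma h x + altDigamma h (x + π) = stepDigamma h x + C := by
  obtain ⟨C, hC⟩ := exists_altLog_add_altLog_shift
  refine ⟨C / h, fun x hx => ?_⟩
  have h1 := hC x hx
  have h2 := (altConvex_one_div_pow one_ne_zero).altSum_add_altSum_shift hx
  have h3 := (altConvex_one_div_pow two_ne_zero).altSum_add_altSum_shift hx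
  have h4 := (altConvex_remainder hh).altSum_add_altSum_shift hx
  unfold altDigamma stepDigamma altPow
  simp only [pow_one] at *
  linear_combination h1 / h - h2 / 2 - h / 12 * h3 + h4

/-- The first term of `altPow 1 (π - x)` is the pole, and the rest is `-altPow 1 (2π - x)`. Beyond
`π` one uses `csc x = -csc (2π - x)`. -/
theorem csc_eq_altPow_add_pole {x : ℝ} (h0 : 0 < x) (h2 : x < 2 * π) (hπ : x ≠ π) :
    csc x = altPow 1 x - altPow 1 (2 * π - x) + 1 / (π - x) := by
  have key := fun {y : ℝ} (hy : 0 < y) =>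
    (altConvex_one_div_pow one_ne_zero).altSum_add_altSum_shift hy
  simp only [pow_one] at key
  rcases lt_or_gt_of_ne hπ with h | h
  · have := key (show 0 < π - x by linarith)
    rw [show π - x + π = 2 * π - x by ring] at this
    rw [csc_eq_altPow ⟨h0, h⟩, ← this]
    simp only [altPow, pow_one]
    ring
  · have := key (show 0 < x - π by linarith)
    rw [sub_add_cancel] at this
    have e := csc_eq_altPow (x := 2 * π - x) ⟨by linarith, by linarith⟩
    rw [show π - (2 * π - x) = x - π by ring, csc, sin_two_pi_sub, one_div_neg_eq_neg_one_div] at e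
    rw [csc, show π - x = -(x - π) by ring, one_div_neg_eq_neg_one_div, ← this]
    simp only [altPow, pow_one] at e ⊢
    linarith

theorem csc_add_pi (x : ℝ) : csc (x + π) = -csc x := by
  rw [csc, sin_add_pi, one_div_neg_eq_neg_one_div, csc]

theorem cot_add_pi (x : ℝ) : cot (x + π) = cot x := by
  rw [cot_eq_cos_div_sin, sin_add_pi, cos_add_pi, neg_div_neg_eq, cot_eq_cos_div_sin]

theorem sum_Ico_succ_sub (F : ℕ → ℝ) {n : ℕ} (hn : 1 ≤ n) :
    ∑ l ∈ Finset.Ico 1 n, (F (l + 1) - F l) = F n - F 1 := by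
  induction n, hn using Nat.le_induction with
  | base => simp
  | succ n hn ih => rw [Finset.sum_Ico_succ_top hn, ih]; ring

theorem sum_csc_eq {h φ ψ : ℝ} {n : ℕ} (hh : 0 < h) (hn : 1 ≤ n) (hφ : φ ∈ Ioo 0 π)
    (hψ : ψ ∈ Ioo 0 π) (hend : φ + n * h = ψ + π) (hne : ∀ k : ℤ, π - φ ≠ k * h) :
    ∑ l ∈ Finset.Ico 1 n, csc (φ + l * h) =
      π / h * cot (π * (π - φ) / h) - altDigamma h φ + altDigamma h (π - φ) - altDigamma h ψ
        + altDigamma h (π - ψ) - altPow 1 φ + altPow 1 (π - ψ) := by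
  have hl : ∀ l ∈ Finset.Ico 1 n, 0 < (l : ℝ) * h ∧ (l : ℝ) * h + h ≤ n * h := by
    intro l hl
    rw [Finset.mem_Ico] at hl
    have h1 : (1 : ℝ) ≤ l := by exact_mod_cast hl.1
    have h2 : (l : ℝ) + 1 ≤ n := by exact_mod_cast hl.2
    exact ⟨by positivity, by nlinarith⟩
  -- The reflected argument `2π - φ - lh` decreases with `l`, so its primitive is taken one step
  -- ahead; its increment is then `-altPow 1`, with the required sign.
  have hterm : ∀ l ∈ Finset.Ico 1 n, csc (φ + l * h) =
      ((altDigamma h (φ + (l + 1 : ℕ) * h)) - altDigamma h (φ + l * h)) +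
      (altDigamma h (2 * π - φ - (l + 1 : ℕ) * h + h) - altDigamma h (2 * π - φ - l * h + h)) +
      1 / (π - φ - l * h) := by
    intro l hl'
    obtain ⟨h1, h2⟩ := hl l hl'
    rw [csc_eq_altPow_add_pole (by linarith [hφ.1]) (by linarith [hψ.2]) (fun e => hne l (by
      push_cast; linarith)), ← altDigamma_shift hh (show 0 < φ + l * h by linarith [hφ.1]),
      ← altDigamma_shift hh (show 0 < 2 * π - (φ + l * h) by linarith [hψ.2])]
    push_cast
    rw [show φ + l * h + h = φ + (l + 1) * h by ring,
      show 2 * π - φ - (l + 1) * h + h = 2 * π - (φ + l * h) by ring,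
      show 2 * π - φ - l * h + h = 2 * π - (φ + l * h) + h by ring,
      show π - φ - l * h = π - (φ + l * h) by ring]
    ring
  rw [Finset.sum_congr rfl hterm, Finset.sum_add_distrib, Finset.sum_add_distrib,
    sum_Ico_succ_sub (fun l => altDigamma h (φ + l * h)) hn,
    sum_Ico_succ_sub (fun l => altDigamma h (2 * π - φ - l * h + h)) hn,
    sum_one_div_sub_eq hh hn (by linarith [hφ.2]) (by linarith [hψ.1]) hne]
  -- Moving the endpoints `ψ + π` and `2π - φ` back by `π` cancels both `stepDigamma` values of the
  -- reflection formula, and also `C`.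
  obtain ⟨C, hC⟩ := exists_altDigamma_add_shift hh
  have c1 := hC (π - φ) (by linarith [hφ.2])
  have c2 := hC ψ hψ.1
  have s1 := altDigamma_shift hh hφ.1
  have s2 := altDigamma_shift hh (show 0 < π - ψ by linarith [hψ.2])
  rw [show π - φ + π = 2 * π - φ by ring] at c1
  rw [hend, show (n : ℝ) * h - (π - φ) = ψ by linarith,
    show 2 * π - φ - n * h + h = π - ψ + h by linarith]
  simp only [Nat.cast_one, one_mul]
  rw [show 2 * π - φ - h + h = 2 * π - φ by ring]
  linarith

/-! ### Exact error identity and the bounds -/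

theorem altDigamma_reflect {h x : ℝ} (hx : x ∈ Ioo 0 π) :
    altDigamma h x - altDigamma h (π - x) = log (tan (x / 2)) / h
      - (altPow 1 x - altPow 1 (π - x)) / 2 - h / 12 * (csc x * cot x)
      + (altSum (remainder h) x - altSum (remainder h) (π - x)) := by
  rw [log_tan_half_eq hx, csc_mul_cot_eq hx]
  unfold altDigamma
  ring

theorem tan_half_pos {x : ℝ} (hx : x ∈ Ioo 0 π) : 0 < tan (x / 2) :=
  tan_pos_of_pos_of_lt_pi_div_two (by linarith [hx.1]) (by linarith [hx.2])

theorem altSum_remainder' {h x : ℝ} (hh : 0 < h) (hx : 0 < x) :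
    altSum (remainder' h) x = h ^ 3 / 120 * altPow 4 x - altSum (remainder h) x := by
  have e := (((altConvex_one_div_pow four_ne_zero).hasSum hx).mul_left (h ^ 3 / 120)).sub
    ((altConvex_remainder hh).hasSum hx)
  refine ((altConvex_remainder' hh).hasSum hx).unique (e.congr_fun fun i => ?_)
  unfold remainder'
  ring

theorem S_sub_leading_eq {φ a h ψ : ℝ} {n : ℕ} (hn : 2 ≤ n) (ha : 0 < a) (hh : h = a * π / n)
    (hφ : φ ∈ Ioo 0 π) (hψ : ψ ∈ Ioo 0 π) (hend : φ + a * π = ψ + π)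
    (hne : ∀ l ∈ Finset.Ico 1 n, ∀ k : ℤ, φ + a * π * l / n ≠ π * k) :
    S n φ a - leading n φ a - coeffA φ a / n =
      (altSum (remainder h) (π - ψ) - altSum (remainder h) φ) +
        (altSum (remainder h) (π - φ) - altSum (remainder h) ψ) := by
  have hn0 : (0 : ℝ) < n := by positivity
  have hh0 : 0 < h := by rw [hh]; positivity
  have hnh : n * h = a * π := by rw [hh]; field_simp
  -- As `0 < π - φ < nh`, an equality would force `0 < k < n`, so a summand would sit at the pole
  -- `π`.
  have hne' : ∀ k : ℤ, π - φ ≠ k * h := by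
    intro k hk
    have h1 : (0 : ℝ) < k := by
      by_contra! hk0
      nlinarith [hφ.2]
    have h2 : (k : ℝ) < n := by
      by_contra! hk0
      nlinarith [hψ.1]
    lift k to ℕ using by exact_mod_cast h1.le
    push_cast at h1 h2 hk
    refine hne k (Finset.mem_Ico.2 ⟨by exact_mod_cast h1, by exact_mod_cast h2⟩) 1 ?_
    rw [show a * π * k / n = k * h by rw [hh]; ring, ← hk]
    push_cast
    ring
  have hS : S n φ a = ∑ l ∈ Finset.Ico 1 n, csc (φ + l * h) := by
    refine Finset.sum_congr rfl fun l _ => ?_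
    rw [hh, show a * π * l / n = l * (a * π / n) by ring]
  have hψ' : π - ψ ∈ Ioo 0 π := ⟨by linarith [hψ.2], by linarith [hψ.1]⟩
  have r1 := altDigamma_reflect (h := h) hφ
  have r2 := altDigamma_reflect (h := h) hψ
  have c1 := csc_eq_altPow hφ
  have c2 := csc_eq_altPow hψ
  have hlog : log (tan (π - π * a / 2 - φ / 2) / tan (φ / 2)) =
      -log (tan (ψ / 2)) - log (tan (φ / 2)) := by
    rw [show π - π * a / 2 - φ / 2 = (π - ψ) / 2 by linarith,
      log_div (tan_half_pos hψ').ne' (tan_half_pos hφ).ne', log_tan_half_eq hψ',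
      log_tan_half_eq hψ, show π - (π - ψ) = ψ by ring]
    ring
  rw [hS, sum_csc_eq hh0 (by omega) hφ hψ (by rw [hnh, hend]) hne', leading, coeffA, hlog, hend,
    csc_add_pi, cot_add_pi]
  have e1 : π / h = n / a := by rw [hh]; field_simp
  have e2 : π * (π - φ) / h = n * (π - φ) / a := by rw [hh]; field_simp
  have e3 : (n : ℝ) / (a * π) = 1 / h := by rw [hh]; field_simp
  have e4 : ∀ X, a * π / 12 * X / n = h / 12 * X := fun X => by rw [hh]; ring
  rw [e1, e2, e3, e4]
  -- The leftover `altPow 1` terms at `φ, π - φ` and at `ψ, π - ψ` combine to `-csc φ / 2` and `csc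
  -- ψ / 2`, the endpoint corrections.
  linear_combination -r1 - r2 + c1 / 2 - c2 / 2

theorem coeffB_div_eq {φ a h ψ : ℝ} {n : ℕ} (hh : h = a * π / n)
    (hφ : φ ∈ Ioo 0 π) (hψ : ψ ∈ Ioo 0 π) (hend : φ + a * π = ψ + π) :
    coeffB φ a / n ^ 3 = h ^ 3 / 120 *
      (altPow 4 φ - altPow 4 (π - φ) + (altPow 4 ψ - altPow 4 (π - ψ))) := by
  have b1 := csc_mul_cot_cube_add_eq hφ
  have b2 := csc_mul_cot_cube_add_eq hψ
  rw [coeffB, hend, csc_add_pi, cot_add_pi, hh]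
  linear_combination (a * π / n) ^ 3 / 720 * (b1 + b2)

theorem S_sub_leading_bounds {n : ℕ} {φ a : ℝ} (hn : 2 ≤ n) (h0 : 0 < φ) (h1 : φ < π)
    (ha1 : 1 - φ / π < a) (ha2 : a < 2 - φ / π)
    (hne : ∀ l ∈ Finset.Ico 1 n, ∀ k : ℤ, φ + a * π * l / n ≠ π * k) :
    (2 * φ + a * π < 2 * π →
      coeffA φ a / n - coeffB φ a / n ^ 3 < S n φ a - leading n φ a ∧
        S n φ a - leading n φ a < coeffA φ a / n) ∧
    (2 * π < 2 * φ + a * π →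
      coeffA φ a / n < S n φ a - leading n φ a ∧
        S n φ a - leading n φ a < coeffA φ a / n - coeffB φ a / n ^ 3) := by
  have hp := pi_pos
  have ha : 0 < a := lt_trans (sub_pos.2 ((div_lt_one hp).2 h1)) ha1
  have hs1 : π - φ < a * π := by
    have := mul_lt_mul_of_pos_right ha1 hp
    rwa [sub_mul, div_mul_cancel₀ _ hp.ne', one_mul] at this
  have hs2 : a * π < 2 * π - φ := by
    have := mul_lt_mul_of_pos_right ha2 hp
    rwa [sub_mul, div_mul_cancel₀ _ hp.ne'] at this
  have hn0 : (0 : ℝ) < n := by positivity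
  obtain ⟨h, hh⟩ : ∃ h, h = a * π / n := ⟨_, rfl⟩
  obtain ⟨ψ, hψe⟩ : ∃ ψ, ψ = φ + a * π - π := ⟨_, rfl⟩
  have hh0 : 0 < h := by rw [hh]; positivity
  have hφ : φ ∈ Ioo 0 π := ⟨h0, h1⟩
  have hψ : ψ ∈ Ioo 0 π := ⟨by linarith, by linarith⟩
  have hend : φ + a * π = ψ + π := by linarith
  have E := S_sub_leading_eq hn ha hh hφ hψ hend hne
  have B := coeffB_div_eq hh hφ hψ hend
  have anti := (altConvex_remainder hh0).altSum_strictAntiOn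
  have anti' := (altConvex_remainder' hh0).altSum_strictAntiOn
  have hφ' : 0 < π - φ := by linarith
  have hψ' : 0 < π - ψ := by linarith [hψ.2]
  have q1 := altSum_remainder' hh0 h0
  have q2 := altSum_remainder' hh0 hφ'
  have q3 := altSum_remainder' hh0 hψ.1
  have q4 := altSum_remainder' hh0 hψ'
  refine ⟨fun hlt => ?_, fun hlt => ?_⟩
  -- Here `φ + ψ < π`, that is `φ < π - ψ` and `ψ < π - φ`; the other case reverses both.
  · have l1 := anti h0 hψ' (by linarith)
    have l2 := anti hψ.1 hφ' (by linarith)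
    have l3 := anti' h0 hψ' (by linarith)
    have l4 := anti' hψ.1 hφ' (by linarith)
    constructor <;> linarith
  · have l1 := anti hψ' h0 (by linarith)
    have l2 := anti hφ' hψ.1 (by linarith)
    have l3 := anti' hψ' h0 (by linarith)
    have l4 := anti' hφ' hψ.1 (by linarith)
    constructor <;> linarith

/-! ### The case a = 1 -/

theorem coeffA_one (φ : ℝ) : coeffA φ 1 = coeffA₁ φ := by
  rw [coeffA, coeffA₁, one_mul, csc_add_pi, cot_add_pi]
  ring

theorem coeffB_one (φ : ℝ) : coeffB φ 1 = coeffB₁ φ := by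
  rw [coeffB, coeffB₁, one_mul, csc_add_pi, cot_add_pi]
  ring

theorem leading_one {φ : ℝ} (n : ℕ) :
    leading n φ 1 = -(n * cot (φ * n) + 2 * n / π * log (tan (φ / 2))) := by
  have e1 : cot (n * (π - φ) / 1) = -cot (φ * n) := by
    rw [div_one, show n * (π - φ) = n * π - φ * n by ring, cot_eq_cos_div_sin,
      cos_nat_mul_pi_sub, sin_nat_mul_pi_sub, cot_eq_cos_div_sin, div_neg,
      mul_div_mul_left _ _ (pow_ne_zero n (neg_ne_zero.2 one_ne_zero))]
  have e2 : tan (π - π * 1 / 2 - φ / 2) = (tan (φ / 2))⁻¹ := by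
    rw [show π - π * 1 / 2 - φ / 2 = π / 2 - φ / 2 by ring, tan_pi_div_two_sub]
  rw [leading, e1, e2, one_mul, csc_add_pi, div_eq_mul_inv (tan (φ / 2))⁻¹, ← sq,
    log_pow, log_inv]
  push_cast
  ring

end CosecantSum

theorem mainTheorem5 :
    (∀ (n : ℕ) (φ a : ℝ), 2 ≤ n → 0 < φ → φ < Real.pi →
      1 - φ / Real.pi < a → a < 2 - φ / Real.pi →
      (∀ l ∈ Finset.Ico 1 n, ∀ k : ℤ,
        φ + a * Real.pi * (l : ℝ) / (n : ℝ) ≠ Real.pi * (k : ℝ)) →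
      (2 * φ + a * Real.pi < 2 * Real.pi →
        CosecantSum.coeffA φ a / (n : ℝ) - CosecantSum.coeffB φ a / (n : ℝ) ^ 3
            < CosecantSum.S n φ a - CosecantSum.leading n φ a ∧
          CosecantSum.S n φ a - CosecantSum.leading n φ a
            < CosecantSum.coeffA φ a / (n : ℝ)) ∧
      (2 * Real.pi < 2 * φ + a * Real.pi →
        CosecantSum.coeffA φ a / (n : ℝ)
            < CosecantSum.S n φ a - CosecantSum.leading n φ a ∧
          CosecantSum.S n φ a - CosecantSum.leading n φ a
            < CosecantSum.coeffA φ a / (n : ℝ) - CosecantSum.coeffB φ a / (n : ℝ) ^ 3)) ∧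
    (∀ (n : ℕ) (φ : ℝ), 2 ≤ n → 0 < φ → φ < Real.pi →
      (∀ k : ℤ, φ ≠ Real.pi * (k : ℝ) / (n : ℝ)) →
      (φ < Real.pi / 2 →
        CosecantSum.coeffA₁ φ / (n : ℝ) - CosecantSum.coeffB₁ φ / (n : ℝ) ^ 3
            < CosecantSum.S n φ 1 + (n : ℝ) * Real.cot (φ * (n : ℝ))
              + 2 * (n : ℝ) / Real.pi * Real.log (Real.tan (φ / 2)) ∧
          CosecantSum.S n φ 1 + (n : ℝ) * Real.cot (φ * (n : ℝ))
              + 2 * (n : ℝ) / Real.pi * Real.log (Real.tan (φ / 2))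
            < CosecantSum.coeffA₁ φ / (n : ℝ)) ∧
      (Real.pi / 2 < φ →
        CosecantSum.coeffA₁ φ / (n : ℝ)
            < CosecantSum.S n φ 1 + (n : ℝ) * Real.cot (φ * (n : ℝ))
              + 2 * (n : ℝ) / Real.pi * Real.log (Real.tan (φ / 2)) ∧
          CosecantSum.S n φ 1 + (n : ℝ) * Real.cot (φ * (n : ℝ))
              + 2 * (n : ℝ) / Real.pi * Real.log (Real.tan (φ / 2))
            < CosecantSum.coeffA₁ φ / (n : ℝ) - CosecantSum.coeffB₁ φ / (n : ℝ) ^ 3)) := by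
  refine ⟨fun n φ a hn h0 h1 ha1 ha2 hne => CosecantSum.S_sub_leading_bounds hn h0 h1 ha1 ha2 hne,
    fun n φ hn h0 h1 hne => ?_⟩
  have hp := Real.pi_pos
  have hd : 0 < φ / Real.pi := by positivity
  have hd' : φ / Real.pi < 1 := (div_lt_one hp).2 h1
  have hn0 : (0 : ℝ) < n := by positivity
  have key := CosecantSum.S_sub_leading_bounds (a := 1) hn h0 h1 (by linarith) (by linarith) ?_
  · rw [CosecantSum.coeffA_one, CosecantSum.coeffB_one, CosecantSum.leading_one, sub_neg_eq_add,
      ← add_assoc] at key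
    exact ⟨fun h => key.1 (by linarith), fun h => key.2 (by linarith)⟩
  · intro l _ k hk
    -- From `φ + πl/n = πk` one gets `φ = π(kn - l)/n`.
    refine hne (k * n - l) ?_
    push_cast
    field_simp at hk ⊢
    linarith
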